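/- Let $n\in\mathbb{N}$ and let $p$ be a real number with $1<p<n$. There exists a constant $C>0$, depending only on $n$ and $p$, with the following property. Let $\Omega\subset\mathbb{R}^n$ be a bounded open set, let $1<q\le\infty$, let $f\in L^q(\Omega)$, and let $u$ be a weak solution of the Dirichlet problem $$-\mathrm{div}\big(|\nabla u|^{p-2}\nabla u\big)=f\ \text{ in }\Omega,\qquad u=0\ \text{ on }\partial\Omega,$$ that is, $u\in W^{1,p}_0(\Omega)$ (the closure of $C_0^\infty(\Omega)$ in $W^{1,p}(\Omega)$) and $$\int_\Omega|\nabla u|^{p-2}\nabla u\cdot\nabla\varphi\,dx=\int_\Omega f\varphi\,dx\qquad\text{for every }\varphi\in C_0^\infty(\Omega),$$ where $\nabla u$ is the weak gradient. Let $\lambda_u(\alpha)=m(\{x\in\Omega:|u(x)|>\alpha\})$ be the distribution function of $u$, where $m$ is Lebesgue measure. Then for all real $\beta>\alpha\ge 0$, $$\lambda_u(\beta)\le\bigg(\frac{C\,\|f\|_{L^q(\Omega)}\,\lambda_u(\alpha)^{\frac{q-1}{q}}}{(\beta-\alpha)^{p-1}}\bigg)^{\frac{n}{n-p}},$$ where $\frac{q-1}{q}=1$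 if $q=\infty$. -/

import Mathlib

open MeasureTheory Filter Topology Distributions Gradient

namespace PPoisson

variable {n : ℕ}

/-- Euclidean space `ℝⁿ`. -/
abbrev Rn (n : ℕ) := EuclideanSpace ℝ (Fin n)

/-- Open subsets of `ℝⁿ`. -/
abbrev OpenSet (n : ℕ) := TopologicalSpace.Opens (Rn n)

/-- Lebesgue measure on `Ω`. -/
noncomputable abbrev leb (Ω : OpenSet n) : Measure (Rn n) :=
  volume.restrict (Ω : Set (Rn n))

/-- The locally integrable vector field `g` is the weak gradient on `Ω` of the locally
integrable function `u`: the integral of `u ∇φ` is minus the integral of `φ g` for every smooth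
`φ` with compact support in `Ω`. -/
structure HasWeakGradient (Ω : OpenSet n) (u : Rn n → ℝ) (g : Rn n → Rn n) : Prop where
  locallyIntegrable : LocallyIntegrableOn u (Ω : Set (Rn n)) volume
  locallyIntegrable_grad : LocallyIntegrableOn g (Ω : Set (Rn n)) volume
  integral_eq : ∀ φ : 𝓓(Ω, ℝ),
    ∫ x in (Ω : Set (Rn n)), u x • ∇ φ x = - ∫ x in (Ω : Set (Rn n)), φ x • g x

/-- `u` belongs to `W₀^{1,p}(Ω)` and has weak gradient `g`: both `u` and `g` are in `L^p(Ω)`, and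
`u` is a limit in the norm of `W^{1,p}(Ω)` of smooth functions with compact support in `Ω`. -/
structure IsW01With (Ω : OpenSet n) (p : ℝ) (u : Rn n → ℝ) (g : Rn n → Rn n) : Prop where
  memLp : MemLp u (ENNReal.ofReal p) (leb Ω)
  memLp_grad : MemLp g (ENNReal.ofReal p) (leb Ω)
  hasWeakGradient : HasWeakGradient Ω u g
  exists_approx : ∃ φ : ℕ → 𝓓(Ω, ℝ),
    Tendsto (fun k => eLpNorm (fun x => u x - φ k x) (ENNReal.ofReal p) (leb Ω)) atTop (𝓝 0) ∧
    Tendsto (fun k => eLpNorm (fun x => g x - ∇ (φ k) x) (ENNReal.ofReal p) (leb Ω))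
      atTop (𝓝 0)

/-- `u ∈ W₀^{1,p}(Ω)` is a weak solution of the Dirichlet problem
`-div (|∇u|^{p-2} ∇u) = f` in `Ω`, `u = 0` on `∂Ω`. For `1 < p`, the vector `|∇u|^{p-2} ∇u` is
understood to be zero where `∇u = 0`. -/
def IsWeakSolution (Ω : OpenSet n) (p : ℝ) (f u : Rn n → ℝ) : Prop :=
  ∃ g : Rn n → Rn n, IsW01With Ω p u g ∧
    ∀ φ : 𝓓(Ω, ℝ),
      ∫ x in (Ω : Set (Rn n)), inner ℝ (‖g x‖ ^ (p - 2) • g x) (∇ φ x)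
        = ∫ x in (Ω : Set (Rn n)), f x * φ x

/-- The distribution function of `u` on `Ω`: the Lebesgue measure of the set of `x ∈ Ω` with
`|u x| > α`. -/
noncomputable def distrib (Ω : OpenSet n) (u : Rn n → ℝ) (α : ℝ) : ENNReal :=
  volume {x | x ∈ Ω ∧ α < |u x|}

end PPoisson

/-!
For `T` a truncation between the heights `α` and `β`, testing the equation with `T(u)` gives
`∫ T'(u) |∇u|^p = ∫ f T(u)`. Since `|T(u)| ≤ β - α` and `T(u)` vanishes where `|u| ≤ α`, Hölder's
inequality bounds the right-hand side by `(β - α) ‖f‖_q λ(α)^{1 - 1/q}`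
(`ofReal_integral_mul_comp_le`). Since `0 ≤ T' ≤ 1` and `p > 1`, the left-hand side dominates
`∫ |∇ T(u)|^p`, so the Sobolev inequality with exponent `p* = np / (n - p)` and Chebyshev's
inequality for `T(u)`, which is comparable to `β - α` where `|u| > β`, bound `λ(β)` in terms of it
(`distrib_le`).

The truncation is taken smooth (`IsSmoothTruncation`), so that `T(φ)` is again a test function when
`φ` is one. Both the tested equation (`integral_deriv_mul_norm_rpow_eq`) and the Sobolev inequality
(`eLpNorm_comp_le`) are proved first for `T(φₖ)`, with test functions `φₖ` tending to `u` in
`W^{1,p}` and almost everywhere, and then pass to the limit; no chain rule for weak gradients is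
needed. A smooth `T` of slope at most one attains only a fixed fraction of the height `β - α`,
which affects the constant alone.
-/

namespace PPoisson

variable {n : ℕ}

/-! ### Smooth truncations -/

lemma exists_deriv_smoothTransition_le :
    ∃ K : ℝ, 0 < K ∧ ∀ x, deriv Real.smoothTransition x ≤ K := by
  have hcont : Continuous (deriv Real.smoothTransition) :=
    (Real.smoothTransition.contDiff (n := 1)).continuous_deriv le_rfl
  obtain ⟨K, hK⟩ := isCompact_Icc.exists_bound_of_continuousOn
    (s := Set.Icc (0 : ℝ) 1) hcont.continuousOn
  refine ⟨max K 1, by positivity, fun x => ?_⟩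
  by_cases hx : x ∈ Set.Icc (0 : ℝ) 1
  · exact ((le_abs_self _).trans (hK x hx)).trans (le_max_left _ _)
  · have hzero : deriv Real.smoothTransition x = 0 := by
      rw [Set.mem_Icc, not_and_or, not_le, not_le] at hx
      rcases hx with hx | hx
      · have : Real.smoothTransition =ᶠ[𝓝 x] fun _ => 0 := by
          filter_upwards [Iio_mem_nhds hx] with y hy
          exact Real.smoothTransition.zero_of_nonpos (le_of_lt hy)
        rw [this.deriv_eq, deriv_const]
      · have : Real.smoothTransition =ᶠ[𝓝 x] fun _ => 1 := by
          filter_upwards [Ioi_mem_nhds hx] with y hy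
          exact Real.smoothTransition.one_of_one_le (le_of_lt hy)
        rw [this.deriv_eq, deriv_const]
    rw [hzero]; positivity

/-- `T` is a smooth version of a multiple of the odd truncation
`s ↦ sign s * min (|s| - α)₊ (β - α)`: it is nondecreasing, 1-Lipschitz, vanishes for `|s| ≤ α`,
is bounded by `β - α`, and exceeds the fixed fraction `c` of that bound for `|s| > β`. -/
structure IsSmoothTruncation (c α β : ℝ) (T : ℝ → ℝ) : Prop where
  contDiff : ContDiff ℝ (⊤ : ℕ∞) T
  deriv_nonneg : ∀ s, 0 ≤ deriv T s
  deriv_le_one : ∀ s, deriv T s ≤ 1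
  eq_zero : ∀ s, |s| ≤ α → T s = 0
  abs_le : ∀ s, |T s| ≤ β - α
  le_abs : ∀ s, β < |s| → c * (β - α) ≤ |T s|

/-- The fraction `c` in `IsSmoothTruncation` can be chosen independently of `α` and `β`, since all
the truncations are rescaled copies of one smooth step. -/
lemma exists_isSmoothTruncation :
    ∃ c : ℝ, 0 < c ∧ ∀ α β : ℝ, 0 ≤ α → α < β → ∃ T : ℝ → ℝ, IsSmoothTruncation c α β T := by
  obtain ⟨K, hK, hSK⟩ := exists_deriv_smoothTransition_le
  -- The factor `1 / 2` absorbs the sum of the two derivatives; the `max` gives `|T| ≤ β - α`.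
  set c : ℝ := 1 / (2 * max K 1) with hc
  have hc0 : 0 < c := by positivity
  have hc1 : c ≤ 1 := by
    rw [hc, div_le_one (by positivity)]
    linarith [le_max_right K 1]
  have hcK : c * K ≤ 1 / 2 := by
    rw [hc, div_mul_eq_mul_div, div_le_iff₀ (by positivity)]
    linarith [le_max_left K 1]
  refine ⟨c, hc0, fun α β hα hαβ => ?_⟩
  set d := β - α with hd
  have hd0 : 0 < d := sub_pos.2 hαβ
  let S := Real.smoothTransition
  have hS : ContDiff ℝ (⊤ : ℕ∞) S := Real.smoothTransition.contDiff
  have hSd : Differentiable ℝ S := hS.differentiable (by simp)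
  have hS' : ∀ x, 0 ≤ deriv S x := fun x => Real.smoothTransition.monotone.deriv_nonneg
  let T : ℝ → ℝ := fun s => c * d * (S ((s - α) / d) - S ((-s - α) / d))
  have hT : ∀ s, HasDerivAt T (c * (deriv S ((s - α) / d) + deriv S ((-s - α) / d))) s := by
    intro s
    have h1 : HasDerivAt (fun s : ℝ => (s - α) / d) (1 / d) s :=
      ((hasDerivAt_id s).sub_const α).div_const d
    have h2 : HasDerivAt (fun s : ℝ => (-s - α) / d) (-1 / d) s :=
      ((hasDerivAt_id s).neg.sub_const α).div_const d
    have h3 := ((((hSd _).hasDerivAt.comp s h1).sub ((hSd _).hasDerivAt.comp s h2)).const_mul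
      (c * d))
    refine h3.congr_deriv ?_
    field_simp
    ring
  have hS0 : ∀ x, 0 ≤ S x := Real.smoothTransition.nonneg
  have hS1 : ∀ x, S x ≤ 1 := Real.smoothTransition.le_one
  refine ⟨T, ⟨?_, ?_, ?_, ?_, ?_, ?_⟩⟩
  · exact contDiff_const.mul ((hS.comp ((contDiff_id.sub contDiff_const).div_const d)).sub
      (hS.comp ((contDiff_id.neg.sub contDiff_const).div_const d)))
  · intro s
    rw [(hT s).deriv]
    exact mul_nonneg hc0.le (add_nonneg (hS' _) (hS' _))
  · intro s
    rw [(hT s).deriv]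
    nlinarith [hSK ((s - α) / d), hSK ((-s - α) / d)]
  · intro s hs
    have h := abs_le.1 hs
    have h1 : S ((s - α) / d) = 0 := Real.smoothTransition.zero_of_nonpos
      (div_nonpos_of_nonpos_of_nonneg (by linarith) hd0.le)
    have h2 : S ((-s - α) / d) = 0 := Real.smoothTransition.zero_of_nonpos
      (div_nonpos_of_nonpos_of_nonneg (by linarith) hd0.le)
    simp only [T, h1, h2, sub_zero, mul_zero]
  · intro s
    have h1 : |S ((s - α) / d) - S ((-s - α) / d)| ≤ 1 :=
      abs_sub_le_iff.2 ⟨by linarith [hS0 ((-s - α) / d), hS1 ((s - α) / d)],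
        by linarith [hS1 ((-s - α) / d), hS0 ((s - α) / d)]⟩
    calc |T s| = c * d * |S ((s - α) / d) - S ((-s - α) / d)| := by
          rw [abs_mul, abs_of_pos (mul_pos hc0 hd0)]
      _ ≤ 1 * d * 1 := by gcongr
      _ = d := by ring
  · intro s hs
    rcases lt_abs.1 hs with h | h
    · have h1 : S ((s - α) / d) = 1 := Real.smoothTransition.one_of_one_le
        ((one_le_div hd0).2 (by linarith))
      have h2 : S ((-s - α) / d) = 0 := Real.smoothTransition.zero_of_nonpos
        (div_nonpos_of_nonpos_of_nonneg (by linarith) hd0.le)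
      simp only [T, h1, h2, sub_zero, mul_one]
      exact le_abs_self _
    · have h1 : S ((-s - α) / d) = 1 := Real.smoothTransition.one_of_one_le
        ((one_le_div hd0).2 (by linarith))
      have h2 : S ((s - α) / d) = 0 := Real.smoothTransition.zero_of_nonpos
        (div_nonpos_of_nonpos_of_nonneg (by linarith) hd0.le)
      simp only [T, h1, h2, zero_sub, mul_neg, mul_one, abs_neg]
      exact le_abs_self _

/-! ### Test functions and the Sobolev inequality -/

/-- Composition of a test function with a smooth function vanishing at the origin. -/
noncomputable def compTest {Ω : OpenSet n} (T : ℝ → ℝ) (hT : ContDiff ℝ (⊤ : ℕ∞) T) (h0 : T 0 = 0)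
    (φ : 𝓓(Ω, ℝ)) : 𝓓(Ω, ℝ) where
  toFun := T ∘ φ
  contDiff' := hT.comp φ.contDiff
  hasCompactSupport' := φ.hasCompactSupport.comp_left h0
  tsupport_subset' := (closure_mono (Function.support_comp_subset h0 φ)).trans φ.tsupport_subset

lemma compTest_apply {Ω : OpenSet n} {T : ℝ → ℝ} (hT : ContDiff ℝ (⊤ : ℕ∞) T) (h0 : T 0 = 0)
    (φ : 𝓓(Ω, ℝ)) (x : Rn n) : compTest T hT h0 φ x = T (φ x) := rfl

lemma gradient_compTest {Ω : OpenSet n} {T : ℝ → ℝ} (hT : ContDiff ℝ (⊤ : ℕ∞) T) (h0 : T 0 = 0)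
    (φ : 𝓓(Ω, ℝ)) (x : Rn n) :
    ∇ (compTest T hT h0 φ) x = deriv T (φ x) • ∇ φ x := by
  have hφ : DifferentiableAt ℝ φ x := φ.contDiff.differentiable (by simp) x
  have hTd : DifferentiableAt ℝ T (φ x) := hT.differentiable (by simp) _
  have h : HasFDerivAt (compTest T hT h0 φ) (deriv T (φ x) • fderiv ℝ φ x) x :=
    hTd.hasDerivAt.comp_hasFDerivAt x hφ.hasFDerivAt
  simp [gradient, h.fderiv]

lemma continuous_gradient {Ω : OpenSet n} (φ : 𝓓(Ω, ℝ)) : Continuous (∇ φ) :=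
  (InnerProductSpace.toDual ℝ (Rn n)).symm.continuous.comp
    (φ.contDiff.continuous_fderiv (by simp))

/-- The Gagliardo-Nirenberg-Sobolev inequality for test functions, with the norms taken over `Ω`:
the constant does not depend on `Ω`. -/
lemma exists_sobolev_const {p : ℝ} (hp : 1 < p) (hpn : p < (n : ℝ)) :
    ∃ C : ℝ, 0 < C ∧ ∀ (Ω : OpenSet n) (φ : 𝓓(Ω, ℝ)),
      eLpNorm φ (ENNReal.ofReal (p * (n / (n - p)))) (leb Ω) ≤
        ENNReal.ofReal C * eLpNorm (∇ φ) (ENNReal.ofReal p) (leb Ω) := by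
  have hn : (0 : ℝ) < n := by linarith
  have hnp : 0 < (n : ℝ) - p := by linarith
  refine ⟨SNormLESNormFDerivOfEqConst ℝ (volume : Measure (Rn n)) (p.toNNReal : ℝ) + 1,
    by positivity, fun Ω φ => ?_⟩
  have hφ1 : ContDiff ℝ 1 φ := φ.contDiff.of_le (by exact_mod_cast le_top)
  have h := eLpNorm_le_eLpNorm_fderiv_of_eq (volume : Measure (Rn n)) hφ1 φ.hasCompactSupport
    (p := p.toNNReal) (p' := (p * (n / (n - p))).toNNReal)
    (by simpa using hp.le) (by simpa using hn)
    (by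
      rw [Real.coe_toNNReal _ (by positivity), NNReal.coe_inv, Real.coe_toNNReal _ (by positivity)]
      simp only [finrank_euclideanSpace, Fintype.card_fin]
      field_simp)
  have hsupp : Function.support (fderiv ℝ φ) ⊆ (Ω : Set (Rn n)) :=
    (support_fderiv_subset ℝ).trans φ.tsupport_subset
  have hgrad : eLpNorm (fderiv ℝ φ) (ENNReal.ofReal p) volume
      = eLpNorm (∇ φ) (ENNReal.ofReal p) (leb Ω) := by
    rw [← eLpNorm_restrict_eq_of_support_subset (f := fderiv ℝ φ) hsupp]
    refine eLpNorm_congr_norm_ae (.of_forall fun x => ?_)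
    simp [gradient]
  calc eLpNorm φ (ENNReal.ofReal (p * (n / (n - p)))) (leb Ω)
      ≤ eLpNorm φ (ENNReal.ofReal (p * (n / (n - p)))) volume :=
        eLpNorm_mono_measure _ Measure.restrict_le_self
    _ ≤ _ := h
    _ ≤ _ := by
      rw [← hgrad, ENNReal.ofReal, ENNReal.ofReal]
      gcongr
      exact NNReal.le_toNNReal_of_coe_le (by simp)

/-! ### Passage to the limit -/

lemma IsW01With.exists_ae_approx {Ω : OpenSet n} {p : ℝ} (hp : 1 < p) {u : Rn n → ℝ}
    {g : Rn n → Rn n} (h : IsW01With Ω p u g) :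
    ∃ φ : ℕ → 𝓓(Ω, ℝ),
      (∀ᵐ x ∂leb Ω, Tendsto (fun k => φ k x) atTop (𝓝 (u x))) ∧
      Tendsto (fun k => eLpNorm (fun x => ∇ (φ k) x - g x) (ENNReal.ofReal p) (leb Ω))
        atTop (𝓝 0) := by
  obtain ⟨φ, h1, h2⟩ := h.exists_approx
  have hm : TendstoInMeasure (leb Ω) (fun k => (φ k : Rn n → ℝ)) atTop u := by
    refine tendstoInMeasure_of_tendsto_eLpNorm (p := ENNReal.ofReal p)
      (ENNReal.ofReal_pos.2 (by linarith)).ne'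
      (fun k => (φ k).continuous.aestronglyMeasurable) h.memLp.1 (h1.congr fun k => ?_)
    exact eLpNorm_sub_comm u (φ k) _ _
  obtain ⟨ns, hns, hae⟩ := hm.exists_seq_tendsto_ae
  refine ⟨fun k => φ (ns k), hae, (h2.comp hns.tendsto_atTop).congr fun k => ?_⟩
  exact eLpNorm_sub_comm g (∇ (φ (ns k))) _ _

lemma inner_flux_self {p : ℝ} (hp : 1 < p) (v : Rn n) :
    inner ℝ (‖v‖ ^ (p - 2) • v) v = ‖v‖ ^ p := by
  rw [real_inner_smul_left, real_inner_self_eq_norm_sq]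
  rcases eq_or_ne v 0 with rfl | hv
  · simp [Real.zero_rpow (by linarith : p ≠ 0)]
  · rw [← Real.rpow_natCast, ← Real.rpow_add (norm_pos_iff.2 hv)]
    norm_num

lemma memLp_flux {μ : Measure (Rn n)} {p : ℝ} (hp : 1 < p) {g : Rn n → Rn n}
    (hg : MemLp g (ENNReal.ofReal p) μ) :
    MemLp (fun x => ‖g x‖ ^ (p - 2) • g x) (ENNReal.ofReal p.conjExponent) μ := by
  have hp1 : 0 < p - 1 := by linarith
  have h := hg.norm_rpow_div (ENNReal.ofReal (p - 1))
  rw [ENNReal.toReal_ofReal hp1.le, ← ENNReal.ofReal_div_of_pos hp1] at h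
  refine MemLp.of_le h ((hg.1.norm.aemeasurable.pow_const _).aestronglyMeasurable.smul hg.1)
    (.of_forall fun x => ?_)
  rw [norm_smul, Real.norm_of_nonneg (by positivity), Real.norm_of_nonneg (by positivity)]
  rcases eq_or_ne (g x) 0 with hv | hv
  · simp [hv, Real.zero_rpow hp1.ne']
  · rw [← Real.rpow_add_one (norm_pos_iff.2 hv).ne']
    apply le_of_eq; congr 1; ring

/-- Pairings of a fixed field in `L^{p'}` with fields tending to zero in `L^p`, multiplied by
scalar weights in `[0, 1]`, tend to zero. -/
lemma tendsto_integral_inner_smul_zero {μ : Measure (Rn n)} {p : ℝ} (hp : 1 < p)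
    {F : Rn n → Rn n} (hF : MemLp F (ENNReal.ofReal p.conjExponent) μ) {w : ℕ → Rn n → Rn n}
    (hw : ∀ k, AEStronglyMeasurable (w k) μ)
    (hlim : Tendsto (fun k => eLpNorm (w k) (ENNReal.ofReal p) μ) atTop (𝓝 0))
    {a : ℕ → Rn n → ℝ} (ha0 : ∀ k x, 0 ≤ a k x) (ha1 : ∀ k x, a k x ≤ 1) :
    Tendsto (fun k => ∫ x, inner ℝ (F x) (a k x • w k x) ∂μ) atTop (𝓝 0) := by
  have hpq := (Real.HolderConjugate.conjExponent hp).symm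
  have : ENNReal.HolderTriple (ENNReal.ofReal p.conjExponent) (ENNReal.ofReal p) 1 :=
    hpq.ennrealOfReal
  have hbound : ∀ k, ‖∫ x, inner ℝ (F x) (a k x • w k x) ∂μ‖ₑ ≤
      eLpNorm F (ENNReal.ofReal p.conjExponent) μ * eLpNorm (w k) (ENNReal.ofReal p) μ := by
    intro k
    calc ‖∫ x, inner ℝ (F x) (a k x • w k x) ∂μ‖ₑ
        ≤ ∫⁻ x, ‖inner ℝ (F x) (a k x • w k x)‖ₑ ∂μ := enorm_integral_le_lintegral_enorm _
      _ ≤ ∫⁻ x, ‖‖F x‖ * ‖w k x‖‖ₑ ∂μ := by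
        refine lintegral_mono fun x => enorm_le_iff_norm_le.2 ?_
        rw [real_inner_smul_right, norm_mul, Real.norm_of_nonneg (ha0 k x), norm_mul, norm_norm,
          norm_norm]
        calc a k x * ‖inner ℝ (F x) (w k x)‖ ≤ 1 * (‖F x‖ * ‖w k x‖) :=
              mul_le_mul (ha1 k x) (norm_inner_le_norm _ _) (norm_nonneg _) zero_le_one
          _ = _ := one_mul _
      _ = eLpNorm (fun x => ‖F x‖ * ‖w k x‖) 1 μ := (eLpNorm_one_eq_lintegral_enorm).symm
      _ ≤ (1 : NNReal) * eLpNorm F (ENNReal.ofReal p.conjExponent) μ *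
          eLpNorm (w k) (ENNReal.ofReal p) μ :=
        eLpNorm_le_eLpNorm_mul_eLpNorm_of_nnnorm hF.1 (hw k) (fun v w => ‖v‖ * ‖w‖) 1
          (.of_forall fun x => by simp)
      _ = _ := by simp
  rw [tendsto_zero_iff_enorm_tendsto_zero]
  refine tendsto_of_tendsto_of_tendsto_of_le_of_le tendsto_const_nhds ?_ (fun k => zero_le)
    hbound
  simpa using ENNReal.Tendsto.const_mul hlim (Or.inr hF.2.ne)

/-- Convergence of the energies `∫ T'(φₖ) |g|^p`, by dominated convergence. -/
lemma tendsto_integral_weight {μ : Measure (Rn n)} {p : ℝ} (hp : 1 < p) {g : Rn n → Rn n}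
    (hg : MemLp g (ENNReal.ofReal p) μ) {D : ℝ → ℝ} (hD : Continuous D) (hD0 : ∀ s, 0 ≤ D s)
    (hD1 : ∀ s, D s ≤ 1) {φ : ℕ → Rn n → ℝ} {u : Rn n → ℝ} (hφ : ∀ k, Continuous (φ k))
    (hlim : ∀ᵐ x ∂μ, Tendsto (fun k => φ k x) atTop (𝓝 (u x))) :
    Tendsto (fun k => ∫ x, D (φ k x) * ‖g x‖ ^ p ∂μ) atTop (𝓝 (∫ x, D (u x) * ‖g x‖ ^ p ∂μ)) := by
  have hint := hg.integrable_norm_rpow (ENNReal.ofReal_pos.2 (by linarith)).ne'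
    ENNReal.ofReal_ne_top
  rw [ENNReal.toReal_ofReal (by linarith)] at hint
  refine tendsto_integral_of_dominated_convergence (fun x => ‖g x‖ ^ p)
    (fun k => (hD.comp (hφ k)).aestronglyMeasurable.mul hint.1) hint
    (fun k => .of_forall fun x => ?_) ?_
  · rw [norm_mul, Real.norm_of_nonneg (hD0 _), Real.norm_of_nonneg (by positivity)]
    exact mul_le_of_le_one_left (by positivity) (hD1 _)
  · filter_upwards [hlim] with x hx
    exact ((hD.tendsto _).comp hx).mul_const _

/-- The weak equation tested with `T(u)`, where `T` is a bounded smooth function, vanishing at the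
origin, with slope in `[0, 1]`. -/
lemma integral_deriv_mul_norm_rpow_eq {Ω : OpenSet n} {p : ℝ} (hp : 1 < p)
    {f u : Rn n → ℝ} {g : Rn n → Rn n} (hf : Integrable f (leb Ω))
    (hg : MemLp g (ENNReal.ofReal p) (leb Ω))
    (hsol : ∀ φ : 𝓓(Ω, ℝ), ∫ x in (Ω : Set (Rn n)), inner ℝ (‖g x‖ ^ (p - 2) • g x) (∇ φ x)
        = ∫ x in (Ω : Set (Rn n)), f x * φ x)
    {φ : ℕ → 𝓓(Ω, ℝ)} (hφ : ∀ᵐ x ∂leb Ω, Tendsto (fun k => φ k x) atTop (𝓝 (u x)))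
    (hφg : Tendsto (fun k => eLpNorm (fun x => ∇ (φ k) x - g x) (ENNReal.ofReal p) (leb Ω))
        atTop (𝓝 0))
    {T : ℝ → ℝ} (hT : ContDiff ℝ (⊤ : ℕ∞) T) (h0 : T 0 = 0) (hT0 : ∀ s, 0 ≤ deriv T s)
    (hT1 : ∀ s, deriv T s ≤ 1) {M : ℝ} (hM : ∀ s, |T s| ≤ M) :
    ∫ x, deriv T (u x) * ‖g x‖ ^ p ∂leb Ω = ∫ x, f x * T (u x) ∂leb Ω := by
  have hT' : Continuous (deriv T) := hT.continuous_deriv (by simp)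
  have hF := memLp_flux hp hg
  have hpq := (Real.HolderConjugate.conjExponent hp).symm
  have : ENNReal.HolderTriple (ENNReal.ofReal p.conjExponent) (ENNReal.ofReal p) 1 :=
    hpq.ennrealOfReal
  have hgm : ∀ k, AEStronglyMeasurable (fun x => ∇ (φ k) x - g x) (leb Ω) := fun k =>
    (continuous_gradient (φ k)).aestronglyMeasurable.sub hg.1
  -- The left-hand sides of the equation tested with `T(φₖ)`.
  have hL : Tendsto (fun k => ∫ x, inner ℝ (‖g x‖ ^ (p - 2) • g x)
      (∇ (compTest T hT h0 (φ k)) x) ∂leb Ω) atTop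
      (𝓝 (∫ x, deriv T (u x) * ‖g x‖ ^ p ∂leb Ω)) := by
    have hdiff := tendsto_integral_inner_smul_zero hp hF hgm hφg
      (a := fun k x => deriv T (φ k x)) (fun k x => hT0 _) (fun k x => hT1 _)
    have hmain := tendsto_integral_weight hp hg hT' hT0 hT1 (fun k => (φ k).continuous) hφ
    have hsum := hdiff.add hmain
    rw [zero_add] at hsum
    refine Tendsto.congr' ?_ hsum
    -- The splitting of the integral needs `∇ φₖ - g ∈ L^p`, known for large `k` only.
    filter_upwards [hφg.eventually (gt_mem_nhds ENNReal.zero_lt_top)] with k hk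
    have hmem : MemLp (fun x => deriv T (φ k x) • (∇ (φ k) x - g x)) (ENNReal.ofReal p)
        (leb Ω) := by
      refine MemLp.of_le (⟨hgm k, hk⟩ : MemLp _ _ _)
        ((hT'.comp (φ k).continuous).aestronglyMeasurable.smul (hgm k)) (.of_forall fun x => ?_)
      rw [norm_smul, Real.norm_of_nonneg (hT0 _)]
      exact mul_le_of_le_one_left (norm_nonneg _) (hT1 _)
    have hmem' : MemLp (fun x => deriv T (φ k x) • g x) (ENNReal.ofReal p) (leb Ω) := by
      refine MemLp.of_le hg
        ((hT'.comp (φ k).continuous).aestronglyMeasurable.smul hg.1) (.of_forall fun x => ?_)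
      rw [norm_smul, Real.norm_of_nonneg (hT0 _)]
      exact mul_le_of_le_one_left (norm_nonneg _) (hT1 _)
    have hinner : ∀ w : Rn n → Rn n, MemLp w (ENNReal.ofReal p) (leb Ω) →
        Integrable (fun x => inner ℝ (‖g x‖ ^ (p - 2) • g x) (w x)) (leb Ω) := by
      intro w hw
      refine Integrable.mono' (MemLp.integrable_mul hF.norm hw.norm) (hF.1.inner hw.1)
        (.of_forall fun x => norm_inner_le_norm _ _)
    have heq : ∀ x, deriv T (φ k x) * ‖g x‖ ^ p
        = inner ℝ (‖g x‖ ^ (p - 2) • g x) (deriv T (φ k x) • g x) := fun x => by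
      rw [real_inner_smul_right, inner_flux_self hp]
    simp_rw [heq]
    rw [← integral_add (hinner _ hmem) (hinner _ hmem')]
    refine integral_congr_ae (.of_forall fun x => ?_)
    simp only [gradient_compTest]
    rw [← inner_add_right, ← smul_add, sub_add_cancel]
  have hR : Tendsto (fun k => ∫ x, f x * compTest T hT h0 (φ k) x ∂leb Ω) atTop
      (𝓝 (∫ x, f x * T (u x) ∂leb Ω)) := by
    refine tendsto_integral_of_dominated_convergence (fun x => ‖f x‖ * M)
      (fun k => hf.1.mul (compTest T hT h0 (φ k)).continuous.aestronglyMeasurable)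
      (hf.norm.mul_const M) (fun k => .of_forall fun x => ?_) ?_
    · rw [norm_mul, compTest_apply]
      exact mul_le_mul_of_nonneg_left (hM _) (norm_nonneg _)
    · filter_upwards [hφ] with x hx
      exact ((hT.continuous.tendsto _).comp hx).const_mul _
  exact tendsto_nhds_unique hL (hR.congr fun k => (hsol _).symm)

/-- The Sobolev inequality for `T(u)`, with the Dirichlet integral of `T(u)` replaced by the larger
quantity `∫ T'(u) |∇u|^p`, which is the one that the weak equation controls. -/
lemma eLpNorm_comp_le {Ω : OpenSet n} {p r C : ℝ} (hp : 1 < p)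
    (hC : ∀ φ : 𝓓(Ω, ℝ), eLpNorm φ (ENNReal.ofReal r) (leb Ω) ≤
        ENNReal.ofReal C * eLpNorm (∇ φ) (ENNReal.ofReal p) (leb Ω))
    {u : Rn n → ℝ} {g : Rn n → Rn n} (hg : MemLp g (ENNReal.ofReal p) (leb Ω))
    {φ : ℕ → 𝓓(Ω, ℝ)} (hφ : ∀ᵐ x ∂leb Ω, Tendsto (fun k => φ k x) atTop (𝓝 (u x)))
    (hφg : Tendsto (fun k => eLpNorm (fun x => ∇ (φ k) x - g x) (ENNReal.ofReal p) (leb Ω))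
        atTop (𝓝 0))
    {T : ℝ → ℝ} (hT : ContDiff ℝ (⊤ : ℕ∞) T) (h0 : T 0 = 0) (hT0 : ∀ s, 0 ≤ deriv T s)
    (hT1 : ∀ s, deriv T s ≤ 1) :
    eLpNorm (fun x => T (u x)) (ENNReal.ofReal r) (leb Ω) ≤
      ENNReal.ofReal C * ENNReal.ofReal (∫ x, deriv T (u x) * ‖g x‖ ^ p ∂leb Ω) ^ (1 / p) := by
  have hp0 : 0 < p := by linarith
  have hT' : Continuous (deriv T) := hT.continuous_deriv (by simp)
  have hgm : ∀ k, AEStronglyMeasurable (fun x => ∇ (φ k) x - g x) (leb Ω) := fun k =>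
    (continuous_gradient (φ k)).aestronglyMeasurable.sub hg.1
  have hint := hg.integrable_norm_rpow (ENNReal.ofReal_pos.2 hp0).ne' ENNReal.ofReal_ne_top
  rw [ENNReal.toReal_ofReal hp0.le] at hint
  have hmeas : ∀ k, AEStronglyMeasurable (fun x => deriv T (φ k x)) (leb Ω) := fun k =>
    (hT'.comp (φ k).continuous).aestronglyMeasurable
  have hweighted : ∀ k, eLpNorm (fun x => deriv T (φ k x) • g x) (ENNReal.ofReal p) (leb Ω) ≤
      ENNReal.ofReal (∫ x, deriv T (φ k x) * ‖g x‖ ^ p ∂leb Ω) ^ (1 / p) := by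
    intro k
    have hnn : ∀ x, 0 ≤ deriv T (φ k x) * ‖g x‖ ^ p := fun x =>
      mul_nonneg (hT0 _) (by positivity)
    have hint' : Integrable (fun x => deriv T (φ k x) * ‖g x‖ ^ p) (leb Ω) := by
      refine Integrable.mono' hint ((hmeas k).mul hint.1) (.of_forall fun x => ?_)
      rw [Real.norm_of_nonneg (hnn x)]
      exact mul_le_of_le_one_left (by positivity) (hT1 _)
    rw [eLpNorm_eq_lintegral_rpow_enorm_toReal (ENNReal.ofReal_pos.2 hp0).ne'
      ENNReal.ofReal_ne_top, ENNReal.toReal_ofReal hp0.le,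
      ofReal_integral_eq_lintegral_ofReal hint' (.of_forall hnn)]
    refine ENNReal.rpow_le_rpow (lintegral_mono fun x => ?_) (by positivity)
    rw [← ofReal_norm, ENNReal.ofReal_rpow_of_nonneg (norm_nonneg _) hp0.le]
    refine ENNReal.ofReal_le_ofReal ?_
    rw [norm_smul, Real.norm_of_nonneg (hT0 _), Real.mul_rpow (hT0 _) (norm_nonneg _)]
    refine mul_le_mul_of_nonneg_right ?_ (by positivity)
    exact Real.rpow_le_self_of_le_one (hT0 _) (hT1 _) hp.le
  have hbound : ∀ k, eLpNorm (fun x => T (φ k x)) (ENNReal.ofReal r) (leb Ω) ≤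
      ENNReal.ofReal C * (eLpNorm (fun x => ∇ (φ k) x - g x) (ENNReal.ofReal p) (leb Ω) +
        ENNReal.ofReal (∫ x, deriv T (φ k x) * ‖g x‖ ^ p ∂leb Ω) ^ (1 / p)) := by
    intro k
    refine (hC (compTest T hT h0 (φ k))).trans ?_
    gcongr
    have heq : ∇ (compTest T hT h0 (φ k)) = (fun x => deriv T (φ k x) • (∇ (φ k) x - g x)) +
        fun x => deriv T (φ k x) • g x := by
      funext x
      rw [gradient_compTest, Pi.add_apply, ← smul_add, sub_add_cancel]
    rw [heq]
    refine (eLpNorm_add_le ((hmeas k).smul (hgm k)) ((hmeas k).smul hg.1) ?_).trans ?_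
    · simpa using hp.le
    · refine add_le_add (eLpNorm_mono fun x => ?_) (hweighted k)
      rw [Pi.smul_apply', norm_smul, Real.norm_of_nonneg (hT0 _)]
      exact mul_le_of_le_one_left (norm_nonneg _) (hT1 _)
  have hmain := tendsto_integral_weight hp hg hT' hT0 hT1 (fun k => (φ k).continuous) hφ
  have hlim : Tendsto (fun k => ENNReal.ofReal C *
      (eLpNorm (fun x => ∇ (φ k) x - g x) (ENNReal.ofReal p) (leb Ω) +
        ENNReal.ofReal (∫ x, deriv T (φ k x) * ‖g x‖ ^ p ∂leb Ω) ^ (1 / p))) atTop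
      (𝓝 (ENNReal.ofReal C * (0 +
        ENNReal.ofReal (∫ x, deriv T (u x) * ‖g x‖ ^ p ∂leb Ω) ^ (1 / p)))) :=
    ENNReal.Tendsto.const_mul
      (hφg.add ((ENNReal.tendsto_ofReal hmain).ennrpow_const _)) (Or.inr ENNReal.ofReal_ne_top)
  rw [zero_add] at hlim
  refine (Lp.eLpNorm_lim_le_liminf_eLpNorm
    (fun k => (hT.continuous.comp (φ k).continuous).aestronglyMeasurable) _ ?_).trans ?_
  · filter_upwards [hφ] with x hx
    exact (hT.continuous.tendsto _).comp hx
  · rw [← hlim.liminf_eq]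
    exact liminf_le_liminf (.of_forall hbound)

/-! ### The distribution function -/

lemma distrib_eq (Ω : OpenSet n) (u : Rn n → ℝ) (α : ℝ) :
    distrib Ω u α = leb Ω {x | α < |u x|} := by
  rw [Measure.restrict_apply' Ω.isOpen.measurableSet, distrib]
  congr 1
  ext x
  exact and_comm

/-- Hölder's inequality on the set where `|u| > α`, outside which `T(u)` vanishes. -/
lemma ofReal_integral_mul_comp_le {Ω : OpenSet n} {f u : Rn n → ℝ} {q : ENNReal} (hq : 1 < q)
    (hf : AEStronglyMeasurable f (leb Ω)) (hu : AEStronglyMeasurable u (leb Ω)) {α d : ℝ}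
    {T : ℝ → ℝ} (hTα : ∀ s, |s| ≤ α → T s = 0) (hTd : ∀ s, |T s| ≤ d) :
    ENNReal.ofReal (∫ x, f x * T (u x) ∂leb Ω) ≤
      ENNReal.ofReal d * (eLpNorm f q (leb Ω) * distrib Ω u α ^ (1 - 1 / q).toReal) := by
  set A : Set (Rn n) := {x | α < |u x|} with hA
  have hAm : NullMeasurableSet A (leb Ω) :=
    nullMeasurableSet_lt aemeasurable_const hu.norm.aemeasurable
  have hexp : 1 / (1 : ENNReal).toReal - 1 / q.toReal = (1 - 1 / q).toReal := by
    rw [ENNReal.toReal_sub_of_le (ENNReal.div_le_of_le_mul (by simpa using hq.le))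
      ENNReal.one_ne_top]
    simp
  calc ENNReal.ofReal (∫ x, f x * T (u x) ∂leb Ω)
      ≤ ‖∫ x, f x * T (u x) ∂leb Ω‖ₑ := by
        rw [← ofReal_norm]
        exact ENNReal.ofReal_le_ofReal (le_abs_self _)
    _ ≤ ∫⁻ x, ‖f x * T (u x)‖ₑ ∂leb Ω := enorm_integral_le_lintegral_enorm _
    _ ≤ ∫⁻ x, A.indicator (fun x => ENNReal.ofReal d * ‖f x‖ₑ) x ∂leb Ω := by
        refine lintegral_mono fun x => ?_
        by_cases hx : x ∈ A
        · rw [Set.indicator_of_mem hx, enorm_mul, mul_comm]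
          gcongr
          rw [← ofReal_norm]
          exact ENNReal.ofReal_le_ofReal (hTd _)
        · rw [Set.indicator_of_notMem hx, hTα _ (not_lt.1 hx)]
          simp
    _ = ENNReal.ofReal d * eLpNorm f 1 ((leb Ω).restrict A) := by
        rw [lintegral_indicator₀ hAm, lintegral_const_mul' _ _ ENNReal.ofReal_ne_top,
          eLpNorm_one_eq_lintegral_enorm]
    _ ≤ _ := by
        gcongr
        refine (eLpNorm_le_eLpNorm_mul_rpow_measure_univ hq.le hf.restrict).trans ?_
        rw [hexp, Measure.restrict_apply_univ, distrib_eq]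
        gcongr
        exact Measure.restrict_le_self

/-- The distribution estimate, with an explicit constant in terms of a Sobolev constant `C` and of
the fraction `c` of the height that the smooth truncations attain. -/
lemma distrib_le {Ω : OpenSet n} (hΩ : Bornology.IsBounded (Ω : Set (Rn n))) {p s c C : ℝ}
    (hp : 1 < p) (hs : 0 < s) (hc : 0 < c) (hC0 : 0 < C)
    (hC : ∀ φ : 𝓓(Ω, ℝ), eLpNorm φ (ENNReal.ofReal (p * s)) (leb Ω) ≤
        ENNReal.ofReal C * eLpNorm (∇ φ) (ENNReal.ofReal p) (leb Ω))
    {q : ENNReal} (hq : 1 < q) {f u : Rn n → ℝ} (hf : MemLp f q (leb Ω))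
    (hu : IsWeakSolution Ω p f u) {α β : ℝ} (hα : 0 ≤ α) (hαβ : α < β)
    {T : ℝ → ℝ} (hT : IsSmoothTruncation c α β T) :
    distrib Ω u β ≤ (ENNReal.ofReal ((C / c) ^ p) * eLpNorm f q (leb Ω) *
      distrib Ω u α ^ (1 - 1 / q).toReal / ENNReal.ofReal ((β - α) ^ (p - 1))) ^ s := by
  obtain ⟨g, hW, hsol⟩ := hu
  obtain ⟨φ, hφ, hφg⟩ := hW.exists_ae_approx hp
  have hp0 : 0 < p := by linarith
  have hd : 0 < β - α := sub_pos.2 hαβ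
  have h0 : T 0 = 0 := hT.eq_zero 0 (by simpa using hα)
  have : IsFiniteMeasure (leb Ω) := ⟨by simpa using hΩ.measure_lt_top⟩
  have hJ := integral_deriv_mul_norm_rpow_eq hp (hf.integrable hq.le) hW.memLp_grad hsol hφ hφg
    hT.contDiff h0 hT.deriv_nonneg hT.deriv_le_one hT.abs_le
  have hSob := eLpNorm_comp_le hp hC hW.memLp_grad hφ hφg hT.contDiff h0 hT.deriv_nonneg
    hT.deriv_le_one
  rw [hJ] at hSob
  have hHol := ofReal_integral_mul_comp_le hq hf.1 hW.memLp.1 hT.eq_zero hT.abs_le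
  set B := eLpNorm f q (leb Ω) * distrib Ω u α ^ (1 - 1 / q).toReal with hB
  have hps : 0 < p * s := mul_pos hp0 hs
  have hcheb := mul_meas_ge_le_pow_eLpNorm' (leb Ω) (ENNReal.ofReal_pos.2 hps).ne'
    ENNReal.ofReal_ne_top (hT.contDiff.continuous.comp_aestronglyMeasurable hW.memLp.1)
    (ENNReal.ofReal (c * (β - α)))
  rw [ENNReal.toReal_ofReal hps.le] at hcheb
  have hcd : 0 < c * (β - α) := mul_pos hc hd
  have hsub : distrib Ω u β ≤
      leb Ω {x | ENNReal.ofReal (c * (β - α)) ≤ ‖T (u x)‖ₑ} := by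
    rw [distrib_eq]
    refine measure_mono fun x hx => ?_
    rw [Set.mem_ofPred_eq, ← ofReal_norm]
    exact ENNReal.ofReal_le_ofReal (hT.le_abs _ hx)
  have hkey : ENNReal.ofReal (c * (β - α)) ^ (p * s) * distrib Ω u β ≤
      (ENNReal.ofReal (C ^ p) * (ENNReal.ofReal (β - α) * B)) ^ s := by
    calc ENNReal.ofReal (c * (β - α)) ^ (p * s) * distrib Ω u β
        ≤ eLpNorm (fun x => T (u x)) (ENNReal.ofReal (p * s)) (leb Ω) ^ (p * s) :=
          (mul_le_mul_right hsub _).trans hcheb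
      _ ≤ (ENNReal.ofReal C * (ENNReal.ofReal (β - α) * B) ^ (1 / p)) ^ (p * s) := by
          refine ENNReal.rpow_le_rpow (hSob.trans ?_) hps.le
          gcongr
      _ = _ := by
          rw [ENNReal.rpow_mul, ENNReal.mul_rpow_of_nonneg _ _ hp0.le, ← ENNReal.rpow_mul,
            one_div_mul_cancel hp0.ne', ENNReal.rpow_one,
            ENNReal.ofReal_rpow_of_nonneg hC0.le hp0.le]
  set N := ENNReal.ofReal (c * (β - α)) ^ (p * s) with hN
  have hN0 : N ≠ 0 := (ENNReal.rpow_pos (ENNReal.ofReal_pos.2 hcd) ENNReal.ofReal_ne_top).ne'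
  have hNtop : N ≠ ⊤ := ENNReal.rpow_ne_top_of_nonneg hps.le ENNReal.ofReal_ne_top
  refine ((ENNReal.mul_le_iff_le_inv hN0 hNtop).1 hkey).trans_eq ?_
  rw [hN, ENNReal.rpow_mul, ← ENNReal.inv_rpow, ← ENNReal.mul_rpow_of_nonneg _ _ hs.le,
    ENNReal.ofReal_rpow_of_nonneg hcd.le hp0.le,
    ← ENNReal.ofReal_inv_of_pos (Real.rpow_pos_of_pos hcd p), mul_assoc (ENNReal.ofReal _), ← hB,
    div_eq_mul_inv, ← ENNReal.ofReal_inv_of_pos (Real.rpow_pos_of_pos hd _),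
    mul_right_comm, ← mul_assoc, ← mul_assoc, ← ENNReal.ofReal_mul (by positivity),
    ← ENNReal.ofReal_mul (by positivity), ← ENNReal.ofReal_mul (by positivity)]
  congr 3
  rw [Real.mul_rpow hc.le hd.le, Real.div_rpow hC0.le hc.le, Real.rpow_sub_one hd.ne']
  field_simp

end PPoisson

theorem lemma2 (n : ℕ) (p : ℝ) (hp : 1 < p) (hpn : p < (n : ℝ)) :
    ∃ C : ℝ, 0 < C ∧
      ∀ (Ω : TopologicalSpace.Opens (EuclideanSpace ℝ (Fin n))),
        Bornology.IsBounded (Ω : Set (EuclideanSpace ℝ (Fin n))) →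
      ∀ (q : ENNReal), 1 < q →
      ∀ (f u : EuclideanSpace ℝ (Fin n) → ℝ),
        MemLp f q (volume.restrict (Ω : Set (EuclideanSpace ℝ (Fin n)))) →
        PPoisson.IsWeakSolution Ω p f u →
      ∀ (α β : ℝ), 0 ≤ α → α < β →
        PPoisson.distrib Ω u β ≤
          (ENNReal.ofReal C *
              eLpNorm f q (volume.restrict (Ω : Set (EuclideanSpace ℝ (Fin n)))) *
              PPoisson.distrib Ω u α ^ (1 - 1 / q).toReal /
            ENNReal.ofReal ((β - α) ^ (p - 1))) ^ ((n : ℝ) / ((n : ℝ) - p)) := by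
  obtain ⟨c, hc, hT⟩ := PPoisson.exists_isSmoothTruncation
  obtain ⟨C, hC, hSob⟩ := PPoisson.exists_sobolev_const hp hpn
  refine ⟨(C / c) ^ p, by positivity, fun Ω hΩ q hq f u hf hu α β hα hαβ => ?_⟩
  obtain ⟨T, hT⟩ := hT α β hα hαβ
  have hs : 0 < (n : ℝ) / (n - p) := div_pos (by linarith) (by linarith)
  exact PPoisson.distrib_le hΩ hp hs hc hC (hSob Ω) hq hf hu hα hαβ hT
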